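/- Let $(\mathcal A,\varphi)$ be a $C^*$-probability space, that is, a unital $C^*$-algebra $\mathcal A$ with a linear functional $\varphi:\mathcal A\to\mathbb C$ such that $\varphi(\mathbb I)=1$ and $\varphi(a^*a)\ge 0$ for all $a\in\mathcal A$. A self-adjoint $Z\in\mathcal A$ has distribution $\mu$, a probability measure on $\mathbb R$, if $\varphi(Z^r)=\int t^r\,\mu(dt)$ for all $r\ge 0$. Two elements of $\mathcal A$ are free if the unital subalgebras $\mathcal A_1,\mathcal A_2$ that they generate are freely independent: $\varphi(a_1\cdots a_k)=0$ for all $k\ge 1$ whenever $a_j\in\mathcal A_{i(j)}$, $\varphi(a_j)=0$ for all $j$, and $i(j)\neq i(j+1)$ for $1\le j<k$. For $\lambda>1$ and $\alpha>0$ the free gamma law with parameters $\lambda,\alpha$ is the probability measure on $\mathbb R$ with density $$f(x)=\frac{(\lambda-1)\sqrt{\frac{4\lambda}{\alpha^2(\lambda-1)^4}-\left(x-\frac{\lambda+1}{\alpha(\lambda-1)^2}\right)^2}}{2\pi x^2},\qquad \frac{1}{\alpha(1+\sqrt\lambda)^2}<x<\frac{1}{\alpha(1-\sqrt\lambda)^2},$$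 and $f(x)=0$ otherwise. Proposition. Let $X,Y\in\mathcal A$ be self-adjoint, free and identically distributed, with a free gamma law with parameters $\lambda>1$, $\alpha>0$. If $X+Y$ is invertible in $\mathcal A$, which is always the case when $\varphi$ is faithful (that is, when $\varphi(a^*a)=0$ implies $a=0$), then $X+Y$ and $(X+Y)^{-1}X^2(X+Y)^{-1}$ are not free. -/

import Mathlib

open MeasureTheory
open scoped ComplexOrder

namespace FreeProb

/-- A state on a unital `*`-algebra over `ℂ`: a linear functional with `φ 1 = 1` and
`φ (a⋆ a) ≥ 0` (the order on `ℂ` says that the number is real and nonnegative). A unital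
C⋆-algebra together with a state is a C⋆-probability space. -/
structure IsState {A : Type*} [CStarAlgebra A] (φ : A →ₗ[ℂ] ℂ) : Prop where
  map_one : φ 1 = 1
  map_star_mul_self_nonneg : ∀ a : A, 0 ≤ φ (star a * a)

/-- A faithful functional: `φ (a⋆ a) = 0` only for `a = 0`. -/
def IsFaithful {A : Type*} [CStarAlgebra A] (φ : A →ₗ[ℂ] ℂ) : Prop :=
  ∀ a : A, φ (star a * a) = 0 → a = 0

/-- Free independence of a family of unital subalgebras: `φ (a₀ a₁ ⋯ aₙ) = 0` for every nonempty
product of centred elements in which neighbouring factors come from different subalgebras. -/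
def FreelyIndependent {A : Type*} [CStarAlgebra A] (φ : A →ₗ[ℂ] ℂ)
    {ι : Type*} (S : ι → Subalgebra ℂ A) : Prop :=
  ∀ (n : ℕ) (i : Fin (n + 1) → ι) (a : Fin (n + 1) → A),
    (∀ j : Fin n, i j.castSucc ≠ i j.succ) →
    (∀ j, a j ∈ S (i j)) →
    (∀ j, φ (a j) = 0) →
    φ (List.ofFn a).prod = 0

/-- Two random variables are free if the unital subalgebras they generate are. -/
def Free {A : Type*} [CStarAlgebra A] (φ : A →ₗ[ℂ] ℂ) (X Y : A) : Prop :=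
  FreelyIndependent φ ![Algebra.adjoin ℂ {X}, Algebra.adjoin ℂ {Y}]

/-- The self-adjoint random variable `X` has distribution `μ`: `μ` is a probability measure on `ℝ`
whose moments all exist and are the moments of `X`. -/
structure HasDistribution {A : Type*} [CStarAlgebra A] (φ : A →ₗ[ℂ] ℂ) (X : A)
    (μ : Measure ℝ) : Prop where
  isSelfAdjoint : IsSelfAdjoint X
  isProbabilityMeasure : IsProbabilityMeasure μ
  integrable_pow : ∀ r : ℕ, Integrable (fun t : ℝ => t ^ r) μ
  moment : ∀ r : ℕ, φ (X ^ r) = ((∫ t, t ^ r ∂μ : ℝ) : ℂ)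

/-- The density of the free gamma law with parameters `lam > 1` and `α > 0`. -/
noncomputable def freeGammaPDF (lam α : ℝ) : ℝ → ℝ :=
  (Set.Ioo (1 / (α * (1 + √lam) ^ 2)) (1 / (α * (1 - √lam) ^ 2))).indicator fun x =>
    (lam - 1) * √(4 * lam / (α ^ 2 * (lam - 1) ^ 4) - (x - (lam + 1) / (α * (lam - 1) ^ 2)) ^ 2)
      / (2 * Real.pi * x ^ 2)

/-- The free gamma law with parameters `lam > 1` and `α > 0`. -/
noncomputable def freeGamma (lam α : ℝ) : Measure ℝ :=
  volume.withDensity fun x => ENNReal.ofReal (freeGammaPDF lam α x)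

end FreeProb

/-!
Put `S = X + Y` and `V = S⁻¹ X² S⁻¹`, so that `S V S = X²`. If `S` and `V` were free, then
`φ (X² Sᵏ)` and `φ (X² Sᵏ X²)` would be determined by the moments of `S` and the two numbers `φ V`,
`φ (V²)`. On the other hand they are mixed moments of the free pair `X`, `Y`. The first family only
fixes `φ V`: for the free gamma law the resulting relations hold for every `k`. The second family
with `k = 0` fixes `φ (V²)`, and with `k = 1` it gives a polynomial relation between the first five
moments of `X` (`moment_relation`). For the free gamma law this relation fails by a nonzero
multiple of `λ² / (α⁵ (λ - 1)⁹)` (`freeGamma_moments_ne`).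

The mixed moments needed are words of at most five alternating letters
(`FreelyIndependent.map_mul_mul_mul_mul`). The moments of the free gamma law follow from a three-term
recurrence, obtained by integrating the derivative of `xⁿ (R² - (x - c)²) ^ (3 / 2)`
(`semicircleIntegral_recurrence`); the starting values are the total mass and the area of a half
disc.

If `φ` is faithful, the spectrum of `X` and of `Y` lies above the left endpoint of the support of the
law, which is positive (`le_of_mem_spectrum`); hence `X + Y` is strictly positive, and invertible.
-/

namespace FreeProb

/-! ### Mixed moments of free subalgebras -/

section Freeness

variable {A : Type*} [CStarAlgebra A] {φ : A →ₗ[ℂ] ℂ} {ι : Type*} {S : ι → Subalgebra ℂ A}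
  {i j : ι}

lemma sub_smul_one_mem (T : Subalgebra ℂ A) {a : A} (ha : a ∈ T) (z : ℂ) : a - z • 1 ∈ T :=
  T.sub_mem ha (T.smul_mem T.one_mem z)

lemma FreelyIndependent.map_mul (h : FreelyIndependent φ S) (h1 : φ 1 = 1) (hij : i ≠ j)
    {a b : A} (ha : a ∈ S i) (hb : b ∈ S j) : φ (a * b) = φ a * φ b := by
  have key := h 1 ![i, j] ![a - φ a • 1, b - φ b • 1]
    (by simpa [Fin.forall_fin_succ] using hij)
    (by simp [Fin.forall_fin_succ, sub_smul_one_mem, ha, hb])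
    (by simp [Fin.forall_fin_succ, h1])
  simp [sub_mul, mul_sub, h1] at key
  linear_combination key

lemma FreelyIndependent.map_mul_mul (h : FreelyIndependent φ S) (h1 : φ 1 = 1) (hij : i ≠ j)
    {a b a' : A} (ha : a ∈ S i) (hb : b ∈ S j) (ha' : a' ∈ S i) :
    φ (a * b * a') = φ b * φ (a * a') := by
  have key := h 2 ![i, j, i] ![a - φ a • 1, b - φ b • 1, a' - φ a' • 1]
    (by simp [Fin.forall_fin_succ, hij, hij.symm])
    (by simp [Fin.forall_fin_succ, sub_smul_one_mem, ha, hb, ha'])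
    (by simp [Fin.forall_fin_succ, h1])
  simp [sub_mul, mul_sub, h1, ← mul_assoc, h.map_mul h1 hij ha hb,
    h.map_mul h1 hij.symm hb ha'] at key
  linear_combination key

/-- A five-letter mixed moment of two free subalgebras. Shorter words are the cases in which some
of the letters are `1`. -/
lemma FreelyIndependent.map_mul_mul_mul_mul (h : FreelyIndependent φ S) (h1 : φ 1 = 1)
    (hij : i ≠ j) {a b a' b' a'' : A} (ha : a ∈ S i) (hb : b ∈ S j) (ha' : a' ∈ S i)
    (hb' : b' ∈ S j) (ha'' : a'' ∈ S i) :
    φ (a * b * a' * b' * a'') =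
      φ a' * φ (a * a'') * (φ (b * b') - φ b * φ b') + φ b * φ b' * φ (a * a' * a'') := by
  -- The word with `b`, `a'`, `b'` centred is the sum of the fully centred word (`key5`) and the
  -- words in which an outer letter is replaced by its expectation (`key4`, `key4'`).
  have key5 := h 4 ![i, j, i, j, i]
    ![a - φ a • 1, b - φ b • 1, a' - φ a' • 1, b' - φ b' • 1, a'' - φ a'' • 1]
    (by simp [Fin.forall_fin_succ, hij, hij.symm])
    (by simp [Fin.forall_fin_succ, sub_smul_one_mem, ha, hb, ha', hb', ha''])
    (by simp [Fin.forall_fin_succ, h1])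
  have key4 := h 3 ![i, j, i, j]
    ![a - φ a • 1, b - φ b • 1, a' - φ a' • 1, b' - φ b' • 1]
    (by simp [Fin.forall_fin_succ, hij, hij.symm])
    (by simp [Fin.forall_fin_succ, sub_smul_one_mem, ha, hb, ha', hb'])
    (by simp [Fin.forall_fin_succ, h1])
  have key4' := h 3 ![j, i, j, i]
    ![b - φ b • 1, a' - φ a' • 1, b' - φ b' • 1, a'' - φ a'' • 1]
    (by simp [Fin.forall_fin_succ, hij, hij.symm])
    (by simp [Fin.forall_fin_succ, sub_smul_one_mem, hb, ha', hb', ha''])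
    (by simp [Fin.forall_fin_succ, h1])
  have e1 := h.map_mul h1 hij ha hb
  have e2 := h.map_mul h1 hij ha hb'
  have e3 := h.map_mul h1 hij ha ((S j).mul_mem hb hb')
  have e4 := h.map_mul h1 hij.symm hb ha'
  have e5 := h.map_mul h1 hij.symm hb ha''
  have e6 := h.map_mul h1 hij.symm hb ((S i).mul_mem ha' ha'')
  have e7 := h.map_mul h1 hij ha' hb'
  have e8 := h.map_mul h1 hij.symm hb' ha''
  have e9 := h.map_mul h1 hij ((S i).mul_mem ha ha') hb'
  have e10 := h.map_mul h1 hij.symm ((S j).mul_mem hb hb') ha''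
  have f1 := h.map_mul_mul h1 hij ha hb ha'
  have f2 := h.map_mul_mul h1 hij ha hb ha''
  have f3 := h.map_mul_mul h1 hij ha hb ((S i).mul_mem ha' ha'')
  have f4 := h.map_mul_mul h1 hij ha hb' ha''
  have f5 := h.map_mul_mul h1 hij ((S i).mul_mem ha ha') hb' ha''
  have f6 := h.map_mul_mul h1 hij ha ((S j).mul_mem hb hb') ha''
  have f7 := h.map_mul_mul h1 hij ha' hb' ha''
  have f8 := h.map_mul_mul h1 hij.symm hb ha' hb'
  simp only [← mul_assoc] at e3 e6 e9 e10 f3 f5 f6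
  simp [sub_mul, mul_sub, h1, ← mul_assoc, e1, e2, e3, e4, e5, e6, e7, e8, e9, e10, f1, f2, f3,
    f4, f5, f6, f7, f8] at key5 key4 key4'
  linear_combination key5 + φ a'' * key4 + φ a * key4'

end Freeness

/-! ### Moments of the free gamma law -/

section Moments

/-- The integrals `∫ xⁿ √(R² - (x - c)²) dx` over `[c - R, c + R]`, for integer `n`. -/
noncomputable def semicircleIntegral (c R : ℝ) (n : ℤ) : ℝ :=
  ∫ x in (c - R)..(c + R), x ^ n * √(R ^ 2 - (x - c) ^ 2)

lemma intervalIntegrable_zpow_mul_sqrt {c R : ℝ} (hR : 0 < R) (hRc : R < c) (n : ℤ) :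
    IntervalIntegrable (fun x : ℝ => x ^ n * √(R ^ 2 - (x - c) ^ 2)) volume (c - R) (c + R) := by
  apply ContinuousOn.intervalIntegrable_of_Icc (by linarith)
  refine ContinuousOn.mul (fun x hx => ?_) (by fun_prop)
  have : x ≠ 0 := by linarith [hx.1]
  exact (continuousAt_zpow₀ x n (Or.inl this)).continuousWithinAt

/-- The integral of the derivative of `xⁿ (R² - (x - c)²) ^ (3 / 2)` vanishes. -/
lemma semicircleIntegral_recurrence {c R : ℝ} (hR : 0 < R) (hRc : R < c) (n : ℤ) :
    (n + 3) * semicircleIntegral c R (n + 1) =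
      (2 * n + 3) * c * semicircleIntegral c R n +
        n * (R ^ 2 - c ^ 2) * semicircleIntegral c R (n - 1) := by
  have hi := intervalIntegrable_zpow_mul_sqrt hR hRc
  have key := intervalIntegral.integral_eq_sub_of_hasDerivAt_of_le (a := c - R) (b := c + R)
    (f := fun x => x ^ n * ((R ^ 2 - (x - c) ^ 2) * √(R ^ 2 - (x - c) ^ 2)))
    (f' := fun x => (2 * n + 3) * c * (x ^ n * √(R ^ 2 - (x - c) ^ 2)) +
      n * (R ^ 2 - c ^ 2) * (x ^ (n - 1) * √(R ^ 2 - (x - c) ^ 2)) -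
      (n + 3) * (x ^ (n + 1) * √(R ^ 2 - (x - c) ^ 2)))
    (by linarith) ?_ ?_ ?_
  · rw [intervalIntegral.integral_sub (((hi _).const_mul _).add ((hi _).const_mul _))
      ((hi _).const_mul _), intervalIntegral.integral_add ((hi _).const_mul _)
      ((hi _).const_mul _)] at key
    simp only [intervalIntegral.integral_const_mul] at key
    simp only [semicircleIntegral]
    have h1 : R ^ 2 - (c + R - c) ^ 2 = 0 := by ring
    have h2 : R ^ 2 - (c - R - c) ^ 2 = 0 := by ring
    rw [h1, h2] at key
    simp only [zero_mul, mul_zero, sub_zero] at key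
    linarith
  · refine ContinuousOn.mul (fun x hx => ?_) (by fun_prop)
    have : x ≠ 0 := by linarith [hx.1]
    exact (continuousAt_zpow₀ x n (Or.inl this)).continuousWithinAt
  · intro x hx
    have hx0 : x ≠ 0 := by linarith [hx.1]
    have hq : 0 < R ^ 2 - (x - c) ^ 2 := by nlinarith [hx.1, hx.2]
    have hd : HasDerivAt (fun x : ℝ => R ^ 2 - (x - c) ^ 2) (-(2 * (x - c))) x := by
      simpa using (((hasDerivAt_id x).sub_const c).pow 2).const_sub (R ^ 2)
    refine ((hasDerivAt_zpow n x (Or.inl hx0)).mul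
      (hd.mul (hd.sqrt hq.ne'))).congr_deriv ?_
    have hs : √(R ^ 2 - (x - c) ^ 2) ≠ 0 := (Real.sqrt_pos.2 hq).ne'
    have hs2 : √(R ^ 2 - (x - c) ^ 2) ^ 2 = R ^ 2 - (x - c) ^ 2 := Real.sq_sqrt hq.le
    simp only [Pi.mul_apply]
    rw [zpow_add_one₀ hx0, zpow_sub_one₀ hx0]
    generalize √(R ^ 2 - (x - c) ^ 2) = s at hs hs2 ⊢
    rw [← hs2]
    field_simp
    have hR2 : R ^ 2 = s ^ 2 + (x - c) ^ 2 := by linarith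
    rw [hR2]
    ring
  · exact (((hi _).const_mul _).add ((hi _).const_mul _)).sub ((hi _).const_mul _)

lemma semicircleIntegral_zero (c : ℝ) {R : ℝ} (hR : 0 < R) :
    semicircleIntegral c R 0 = Real.pi * R ^ 2 / 2 := by
  have h := intervalIntegral.mul_integral_comp_add_mul (a := -1) (b := 1)
    (f := fun x : ℝ => √(R ^ 2 - (x - c) ^ 2)) R c
  have h2 : ∀ x : ℝ, √(R ^ 2 - (c + R * x - c) ^ 2) = R * √(1 - x ^ 2) := by
    intro x
    rw [show R ^ 2 - (c + R * x - c) ^ 2 = R ^ 2 * (1 - x ^ 2) by ring,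
      Real.sqrt_mul (sq_nonneg R), Real.sqrt_sq hR.le]
  simp only [h2, intervalIntegral.integral_const_mul, integral_sqrt_one_sub_sq] at h
  simp only [semicircleIntegral, zpow_zero, one_mul]
  rw [show c - R = c + R * -1 by ring]
  conv_lhs => rw [show c + R = c + R * 1 by ring]
  rw [← h]
  ring

variable {lam α : ℝ}

/-- The centre of the support of the free gamma law. -/
noncomputable def freeGammaCenter (lam α : ℝ) : ℝ := (lam + 1) / (α * (lam - 1) ^ 2)

/-- Half the length of the support of the free gamma law. -/
noncomputable def freeGammaRadius (lam α : ℝ) : ℝ := 2 * √lam / (α * (lam - 1) ^ 2)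

lemma freeGammaRadius_sq (hlam : 1 < lam) :
    freeGammaRadius lam α ^ 2 = 4 * lam / (α ^ 2 * (lam - 1) ^ 4) := by
  rw [freeGammaRadius, div_pow, mul_pow, Real.sq_sqrt (by linarith)]
  ring

lemma freeGammaRadius_pos (hlam : 1 < lam) (hα : 0 < α) : 0 < freeGammaRadius lam α := by
  have : 0 < lam - 1 := by linarith
  have : 0 < √lam := Real.sqrt_pos.2 (by linarith)
  unfold freeGammaRadius
  positivity

lemma left_endpoint_eq (hlam : 1 < lam) (hα : 0 < α) :
    1 / (α * (1 + √lam) ^ 2) = freeGammaCenter lam α - freeGammaRadius lam α := by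
  have h1 : 1 < √lam := by rw [Real.lt_sqrt] <;> linarith
  have h2 : lam = √lam ^ 2 := (Real.sq_sqrt (by linarith)).symm
  unfold freeGammaCenter freeGammaRadius
  generalize √lam = s at h1 h2 ⊢
  subst h2
  have h3 : s ^ 2 - 1 ≠ 0 := by nlinarith
  have h4 : 1 + s ≠ 0 := by linarith
  field_simp
  ring

lemma right_endpoint_eq (hlam : 1 < lam) (hα : 0 < α) :
    1 / (α * (1 - √lam) ^ 2) = freeGammaCenter lam α + freeGammaRadius lam α := by
  have h1 : 1 < √lam := by rw [Real.lt_sqrt] <;> linarith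
  have h2 : lam = √lam ^ 2 := (Real.sq_sqrt (by linarith)).symm
  unfold freeGammaCenter freeGammaRadius
  generalize √lam = s at h1 h2 ⊢
  subst h2
  have h3 : s ^ 2 - 1 ≠ 0 := by nlinarith
  have h4 : 1 - s ≠ 0 := by linarith
  field_simp
  ring

lemma left_endpoint_pos (lam : ℝ) (hα : 0 < α) : 0 < 1 / (α * (1 + √lam) ^ 2) := by
  positivity

lemma freeGammaRadius_lt_center (hlam : 1 < lam) (hα : 0 < α) :
    freeGammaRadius lam α < freeGammaCenter lam α := by
  have := left_endpoint_pos lam hα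
  rw [left_endpoint_eq hlam hα] at this
  linarith

lemma measurable_freeGammaPDF (lam α : ℝ) : Measurable (freeGammaPDF lam α) := by
  unfold freeGammaPDF
  refine Measurable.indicator ?_ measurableSet_Ioo
  fun_prop

lemma freeGammaPDF_nonneg (hlam : 1 < lam) (α x : ℝ) : 0 ≤ freeGammaPDF lam α x := by
  refine Set.indicator_nonneg (fun x _ => ?_) x
  have : 0 < lam - 1 := by linarith
  positivity

lemma integral_pow_freeGamma (hlam : 1 < lam) (hα : 0 < α) (r : ℕ) :
    ∫ t, t ^ r ∂(freeGamma lam α) = (lam - 1) / (2 * Real.pi) *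
      semicircleIntegral (freeGammaCenter lam α) (freeGammaRadius lam α) (r - 2) := by
  unfold freeGamma
  rw [integral_withDensity_eq_integral_toReal_smul
    (measurable_freeGammaPDF lam α).ennreal_ofReal (by simp)]
  simp only [ENNReal.toReal_ofReal (freeGammaPDF_nonneg hlam α _), smul_eq_mul]
  have hpos := left_endpoint_pos lam hα
  have hle : freeGammaCenter lam α - freeGammaRadius lam α ≤
      freeGammaCenter lam α + freeGammaRadius lam α := by
    linarith [freeGammaRadius_pos hlam hα]
  rw [semicircleIntegral, ← intervalIntegral.integral_const_mul,
    intervalIntegral.integral_of_le hle, integral_Ioc_eq_integral_Ioo,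
    ← integral_indicator measurableSet_Ioo]
  congr 1
  ext x
  rw [freeGammaPDF, freeGammaRadius_sq hlam, right_endpoint_eq hlam hα,
    left_endpoint_eq hlam hα]
  rw [left_endpoint_eq hlam hα] at hpos
  by_cases hx : x ∈ Set.Ioo (freeGammaCenter lam α - freeGammaRadius lam α)
      (freeGammaCenter lam α + freeGammaRadius lam α)
  · rw [Set.indicator_of_mem hx, Set.indicator_of_mem hx]
    have hx0 : x ≠ 0 := (hpos.trans hx.1).ne'
    have hz : x ^ ((r : ℤ) - 2) = x ^ r / x ^ 2 := by
      rw [zpow_sub₀ hx0]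
      norm_cast
    rw [hz]
    simp only [freeGammaCenter]
    field_simp
  · rw [Set.indicator_of_notMem hx, Set.indicator_of_notMem hx, zero_mul]

lemma ae_freeGamma_mem_Icc (lam α : ℝ) :
    ∀ᵐ t ∂(freeGamma lam α), t ∈ Set.Icc (1 / (α * (1 + √lam) ^ 2)) (1 / (α * (1 - √lam) ^ 2)) := by
  unfold freeGamma
  rw [ae_withDensity_iff (measurable_freeGammaPDF lam α).ennreal_ofReal]
  refine Filter.Eventually.of_forall fun x hx => ?_
  by_contra hx'
  refine hx ?_
  rw [freeGammaPDF, Set.indicator_of_notMem (fun h => hx' (Set.Ioo_subset_Icc_self h)),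
    ENNReal.ofReal_zero]

/-- The first five moments of the free gamma law, once its total mass is known to be `1`. -/
lemma moments_freeGamma (hlam : 1 < lam) (hα : 0 < α)
    (hprob : IsProbabilityMeasure (freeGamma lam α)) :
    ∫ t, t ^ 1 ∂(freeGamma lam α) = 1 / (α * (lam - 1)) ∧
    ∫ t, t ^ 2 ∂(freeGamma lam α) = lam / (α ^ 2 * (lam - 1) ^ 3) ∧
    ∫ t, t ^ 3 ∂(freeGamma lam α) = lam * (lam + 1) / (α ^ 3 * (lam - 1) ^ 5) ∧
    ∫ t, t ^ 4 ∂(freeGamma lam α) =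
      lam * (lam ^ 2 + 3 * lam + 1) / (α ^ 4 * (lam - 1) ^ 7) ∧
    ∫ t, t ^ 5 ∂(freeGamma lam α) =
      lam * (lam ^ 3 + 6 * lam ^ 2 + 6 * lam + 1) / (α ^ 5 * (lam - 1) ^ 9) := by
  have hu : 0 < lam - 1 := by linarith
  have hR := freeGammaRadius_pos hlam hα
  have hRc := freeGammaRadius_lt_center hlam hα
  have h0 := integral_pow_freeGamma hlam hα 0
  have h1 := integral_pow_freeGamma hlam hα 1
  have h2 := integral_pow_freeGamma hlam hα 2
  have h3 := integral_pow_freeGamma hlam hα 3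
  have h4 := integral_pow_freeGamma hlam hα 4
  have h5 := integral_pow_freeGamma hlam hα 5
  have r0 := semicircleIntegral_recurrence hR hRc (-1)
  have r1 := semicircleIntegral_recurrence hR hRc 0
  have r2 := semicircleIntegral_recurrence hR hRc 1
  have r3 := semicircleIntegral_recurrence hR hRc 2
  have z := semicircleIntegral_zero (freeGammaCenter lam α) hR
  simp only [pow_zero, integral_const, probReal_univ, smul_eq_mul, mul_one] at h0
  norm_num at h0 h1 h2 h3 h4 h5 r0 r1 r2 r3
  rw [z] at h2
  have hd : freeGammaRadius lam α ^ 2 - freeGammaCenter lam α ^ 2 =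
      -1 / (α ^ 2 * (lam - 1) ^ 2) := by
    rw [freeGammaRadius_sq hlam, freeGammaCenter]
    field_simp
    ring
  have hR2 := freeGammaRadius_sq (α := α) hlam
  have hc : freeGammaCenter lam α = (lam + 1) / (α * (lam - 1) ^ 2) := rfl
  have hpi := Real.pi_pos
  set J := semicircleIntegral (freeGammaCenter lam α) (freeGammaRadius lam α)
  set c := freeGammaCenter lam α
  set R := freeGammaRadius lam α
  set k := (lam - 1) / (2 * Real.pi) with hk
  have hl : lam + 1 ≠ 0 := by linarith
  have hd' : c ^ 2 - R ^ 2 = 1 / (α ^ 2 * (lam - 1) ^ 2) := by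
    rw [← neg_sub, hd, neg_div, neg_neg]
  rw [hd] at r2 r3
  rw [hd'] at r0
  have m2 : k * J 0 = lam / (α ^ 2 * (lam - 1) ^ 3) := by
    rw [z, hR2, hk]; field_simp; ring
  have m1 : k * J (-1) = 1 / (α * (lam - 1)) := by
    have : c * (k * J (-1)) = 2 * (k * J 0) - 1 / (α ^ 2 * (lam - 1) ^ 2) := by
      linear_combination (-k) * r0 + 1 / (α ^ 2 * (lam - 1) ^ 2) * h0
    rw [m2, hc] at this
    have hc0 : (lam + 1) / (α * (lam - 1) ^ 2) ≠ 0 := by positivity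
    apply mul_left_cancel₀ hc0
    rw [this]; field_simp; ring
  have m3 : k * J 1 = lam * (lam + 1) / (α ^ 3 * (lam - 1) ^ 5) := by
    have : k * J 1 = c * (k * J 0) := by linear_combination (k / 3) * r1
    rw [this, m2, hc]; field_simp
  have m4 : k * J 2 = lam * (lam ^ 2 + 3 * lam + 1) / (α ^ 4 * (lam - 1) ^ 7) := by
    have : k * J 2 = (5 * c * (k * J 1) + -1 / (α ^ 2 * (lam - 1) ^ 2) * (k * J 0)) / 4 := by
      linear_combination (k / 4) * r2
    rw [this, m2, m3, hc]; field_simp; ring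
  have m5 : k * J 3 =
      lam * (lam ^ 3 + 6 * lam ^ 2 + 6 * lam + 1) / (α ^ 5 * (lam - 1) ^ 9) := by
    have : k * J 3 = (7 * c * (k * J 2) + 2 * (-1 / (α ^ 2 * (lam - 1) ^ 2)) * (k * J 1)) / 5 := by
      linear_combination (k / 5) * r3
    rw [this, m4, m3, hc]; field_simp; ring
  rw [← z] at h2
  simp only [pow_one]
  exact ⟨h1.trans m1, h2.trans m2, h3.trans m3, h4.trans m4, h5.trans m5⟩

end Moments
/-! ### Invertibility of the sum under a faithful state -/

section Faithful

variable {A : Type*} [CStarAlgebra A] {φ : A →ₗ[ℂ] ℂ}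

lemma HasDistribution.map_aeval {X : A} {μ : Measure ℝ} (hX : HasDistribution φ X μ)
    (p : Polynomial ℝ) :
    Integrable (fun t => p.eval t) μ ∧
      φ (Polynomial.aeval X p) = ((∫ t, p.eval t ∂μ : ℝ) : ℂ) := by
  induction p using Polynomial.induction_on' with
  | add p q hp hq =>
    simp only [Polynomial.eval_add, map_add]
    refine ⟨hp.1.add hq.1, ?_⟩
    rw [integral_add hp.1 hq.1, hp.2, hq.2]
    push_cast
    rfl
  | monomial n a =>
    simp only [Polynomial.eval_monomial, Polynomial.aeval_monomial]
    refine ⟨(hX.integrable_pow n).const_mul a, ?_⟩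
    rw [integral_const_mul, ← Algebra.smul_def, ← Complex.coe_smul, map_smul, hX.moment n]
    simp

/-- A faithful state sees the whole spectrum: a lower bound for the support of the distribution is
a lower bound for the spectrum. The function `max (a - t) 0` is zero on the support, so by
Weierstrass approximation `φ` annihilates its square evaluated at `X`. -/
lemma le_of_mem_spectrum (hφ : IsState φ) (hf : IsFaithful φ) {X : A} {μ : Measure ℝ}
    (hX : HasDistribution φ X μ) {a b : ℝ} (hμ : ∀ᵐ t ∂μ, t ∈ Set.Icc a b) {t : ℝ}
    (ht : t ∈ spectrum ℝ X) : a ≤ t := by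
  let _ := CStarAlgebra.spectralOrder A
  have _ := CStarAlgebra.spectralOrderedRing A
  have hsa := hX.isSelfAdjoint
  have _ := hX.isProbabilityMeasure
  have hpos : ∀ x : A, 0 ≤ x → 0 ≤ φ x := by
    intro x hx
    obtain ⟨y, rfl⟩ := CStarAlgebra.nonneg_iff_eq_star_mul_self.1 hx
    exact hφ.map_star_mul_self_nonneg y
  let f : ℝ → ℝ := fun t => max (a - t) 0
  have hfc : Continuous f := by fun_prop
  have hstar : star (cfc f X) * cfc f X = cfc (fun t => f t * f t) X := by
    rw [(cfc_predicate f X).star_eq, cfc_mul f f X]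
  have hzero : φ (cfc (fun t => f t * f t) X) = 0 := by
    have hnn : 0 ≤ φ (cfc (fun t => f t * f t) X) :=
      hpos _ (cfc_nonneg fun x _ => mul_self_nonneg _)
    refine le_antisymm ?_ hnn
    rw [Complex.le_def]
    refine ⟨?_, (Complex.le_def.1 hnn).2.symm⟩
    refine le_of_forall_pos_le_add fun ε hε => ?_
    obtain ⟨M, hM⟩ := (spectrum.isCompact (𝕜 := ℝ) X).isBounded.subset_closedBall 0
    let L := max M (max |a| |b|)
    obtain ⟨p, hp⟩ := exists_polynomial_near_of_continuousOn (-L) L (fun t => f t * f t)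
      (by fun_prop) (ε / 2) (by linarith)
    -- `q` lies above `f ^ 2` on the spectrum, and below `ε` on the support of `μ`.
    let q : Polynomial ℝ := p + Polynomial.C (ε / 2)
    have hle : cfc (fun t => f t * f t) X ≤ Polynomial.aeval X q := by
      rw [← cfc_polynomial q X]
      refine cfc_mono fun x hx => ?_
      have hxM : |x| ≤ M := by simpa using hM hx
      have := hp x (abs_le.1 (hxM.trans (le_max_left _ _)))
      simp only [q, Polynomial.eval_add, Polynomial.eval_C]
      linarith [(abs_lt.1 this).1]
    have hint : ∫ t, q.eval t ∂μ ≤ ε := by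
      have : ∫ t, q.eval t ∂μ ≤ ∫ _, ε ∂μ := by
        refine integral_mono_ae (hX.map_aeval q).1 (integrable_const ε) ?_
        filter_upwards [hμ] with x hx
        have hxL : |x| ≤ L := by
          refine le_trans ?_ (le_max_right _ _)
          exact abs_le_max_abs_abs hx.1 hx.2
        have hfx : f x = 0 := max_eq_right (by linarith [hx.1])
        have := hp x (abs_le.1 hxL)
        rw [hfx, mul_zero, sub_zero] at this
        simp only [q, Polynomial.eval_add, Polynomial.eval_C]
        linarith [(abs_lt.1 this).2]
      simpa using this
    have h := hpos _ (sub_nonneg.2 hle)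
    rw [map_sub, (hX.map_aeval q).2, sub_nonneg] at h
    have h' := (Complex.le_def.1 h).1
    rw [Complex.ofReal_re] at h'
    simpa using h'.trans hint
  have h0 : cfc f X = 0 := hf _ (by rw [hstar, hzero])
  rw [← cfc_zero ℝ X] at h0
  have := eqOn_of_cfc_eq_cfc h0 hfc.continuousOn continuousOn_const hsa ht
  have hle : a - t ≤ f t := le_max_left _ _
  rw [this] at hle
  simpa using hle

lemma isUnit_add_of_isFaithful (hφ : IsState φ) (hf : IsFaithful φ) {X Y : A} {μ : Measure ℝ}
    (hX : HasDistribution φ X μ) (hY : HasDistribution φ Y μ) {a b : ℝ} (ha : 0 < a)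
    (hμ : ∀ᵐ t ∂μ, t ∈ Set.Icc a b) : IsUnit (X + Y) := by
  let _ := CStarAlgebra.spectralOrder A
  have _ := CStarAlgebra.spectralOrderedRing A
  have hXp : IsStrictlyPositive X :=
    (StarOrderedRing.isStrictlyPositive_iff_spectrum_pos (R := ℝ) X hX.isSelfAdjoint).2
      fun t ht => ha.trans_le (le_of_mem_spectrum hφ hf hX hμ ht)
  have hYp : IsStrictlyPositive Y :=
    (StarOrderedRing.isStrictlyPositive_iff_spectrum_pos (R := ℝ) Y hY.isSelfAdjoint).2
      fun t ht => ha.trans_le (le_of_mem_spectrum hφ hf hY hμ ht)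
  exact (hXp.add_nonneg hYp.nonneg).isUnit

end Faithful

/-! ### The obstruction to freeness -/

section Obstruction

variable {A : Type*} [CStarAlgebra A] {φ : A →ₗ[ℂ] ℂ}

/-- The mixed moments `φ (S V S Sᵏ)` and `φ (S V S Sᵏ S V S)` of free elements, written in terms of
`W = S V S`. -/
lemma Free.map_conj (h1 : φ 1 = 1) {S V W : A} (h : Free φ S V) (hW : W = S * V * S) (k : ℕ) :
    φ (W * S ^ k) = φ V * φ (S ^ (k + 2)) ∧
    φ (W * S ^ k * W) = φ (S ^ (k + 2)) * φ (S ^ 2) * (φ (V * V) - φ V * φ V) +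
      φ V * (φ V * φ (S ^ (k + 4))) := by
  have hS : ∀ n : ℕ, S ^ n ∈ ![Algebra.adjoin ℂ {S}, Algebra.adjoin ℂ {V}] 0 := fun n =>
    Subalgebra.pow_mem _ (Algebra.self_mem_adjoin_singleton ℂ S) n
  have hS1 : S ∈ ![Algebra.adjoin ℂ {S}, Algebra.adjoin ℂ {V}] 0 :=
    Algebra.self_mem_adjoin_singleton ℂ S
  have hV : V ∈ ![Algebra.adjoin ℂ {S}, Algebra.adjoin ℂ {V}] 1 :=
    Algebra.self_mem_adjoin_singleton ℂ V
  have h01 : (0 : Fin 2) ≠ 1 := zero_ne_one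
  constructor
  · have e := FreelyIndependent.map_mul_mul h h1 h01 hS1 hV (hS (k + 1))
    rw [← pow_succ'] at e
    rw [← e, hW, mul_assoc _ S, ← pow_succ']
  · have e := FreelyIndependent.map_mul_mul_mul_mul h h1 h01 hS1 hV (hS (k + 2)) hV hS1
    rw [← pow_two, ← pow_succ', ← pow_succ] at e
    rw [← mul_assoc (φ V), ← e, hW]
    have hpow : S ^ (k + 2) = S * S ^ k * S := by rw [pow_succ, pow_succ']
    simp only [hpow, mul_assoc]

/-- If `X` and `Y` are free with the same first moments `m k` and `S V S = X ^ 2` for some `V`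
free from `S = X + Y`, eliminating the unknown `φ V` and `φ (V * V)` from the values of `φ` at
`X ^ 2`, `X ^ 2 * X ^ 2` and `X ^ 2 * S * X ^ 2` gives an algebraic relation between the moments. -/
lemma moment_relation (h1 : φ 1 = 1) {X Y V : A} (hXY : Free φ X Y) {m : ℕ → ℂ}
    (hX : ∀ r, φ (X ^ r) = m r) (hY : ∀ r, φ (Y ^ r) = m r)
    (hV : Free φ (X + Y) V) (hW : X ^ 2 = (X + Y) * V * (X + Y)) :
    (2 * m 2 + 2 * m 1 ^ 2) ^ 2 * (m 5 + m 1 * m 4) =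
      (2 * m 2 + 2 * m 1 ^ 2) * (2 * m 3 + 6 * m 1 * m 2) * m 4 -
      (2 * m 3 + 6 * m 1 * m 2) * m 2 * (m 4 + 2 * m 3 * m 1 + m 2 ^ 2) +
      (2 * m 2 + 2 * m 1 ^ 2) * m 2 *
        (m 5 + 3 * m 4 * m 1 + 3 * m 3 * m 2 + m 3 * m 1 ^ 2 + m 2 ^ 2 * m 1 - m 2 * m 1 ^ 3) := by
  have hx : ∀ n : ℕ, X ^ n ∈ ![Algebra.adjoin ℂ {X}, Algebra.adjoin ℂ {Y}] 0 := fun n =>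
    Subalgebra.pow_mem _ (Algebra.self_mem_adjoin_singleton ℂ X) n
  have hy : ∀ n : ℕ, Y ^ n ∈ ![Algebra.adjoin ℂ {X}, Algebra.adjoin ℂ {Y}] 1 := fun n =>
    Subalgebra.pow_mem _ (Algebra.self_mem_adjoin_singleton ℂ Y) n
  have h01 : (0 : Fin 2) ≠ 1 := zero_ne_one
  have xy : ∀ a b, φ (X ^ a * Y ^ b) = m a * m b := fun a b => by
    rw [FreelyIndependent.map_mul hXY h1 h01 (hx a) (hy b), hX, hY]
  have yx : ∀ a b, φ (Y ^ a * X ^ b) = m a * m b := fun a b => by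
    rw [FreelyIndependent.map_mul hXY h1 h01.symm (hy a) (hx b), hX, hY]
  have xyx : ∀ a b c, φ (X ^ a * Y ^ b * X ^ c) = m b * m (a + c) := fun a b c => by
    rw [FreelyIndependent.map_mul_mul hXY h1 h01 (hx a) (hy b) (hx c), hY, ← pow_add, hX]
  have yxy : ∀ a b c, φ (Y ^ a * X ^ b * Y ^ c) = m b * m (a + c) := fun a b c => by
    rw [FreelyIndependent.map_mul_mul hXY h1 h01.symm (hy a) (hx b) (hy c), hX, ← pow_add, hY]
  have xyxy : ∀ a b c d, φ (X ^ a * Y ^ b * X ^ c * Y ^ d) =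
      m c * m a * (m (b + d) - m b * m d) + m b * m d * m (a + c) := fun a b c d => by
    have := FreelyIndependent.map_mul_mul_mul_mul hXY h1 h01 (hx a) (hy b) (hx c) (hy d) (hx 0)
    simpa only [pow_zero, mul_one, ← pow_add, hX, hY] using this
  have s2 : φ ((X + Y) ^ 2) = 2 * m 2 + 2 * m 1 ^ 2 := by
    have e : (X + Y) ^ 2 = X ^ 2 + X ^ 1 * Y ^ 1 + Y ^ 1 * X ^ 1 + Y ^ 2 := by noncomm_ring
    rw [e]
    simp only [map_add, hX, hY, xy, yx]
    ring
  have s3 : φ ((X + Y) ^ 3) = 2 * m 3 + 6 * m 1 * m 2 := by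
    have e : (X + Y) ^ 3 = X ^ 3 + X ^ 2 * Y ^ 1 + X ^ 1 * Y ^ 1 * X ^ 1 + X ^ 1 * Y ^ 2 +
        Y ^ 1 * X ^ 2 + Y ^ 1 * X ^ 1 * Y ^ 1 + Y ^ 2 * X ^ 1 + Y ^ 3 := by noncomm_ring
    rw [e]
    simp only [map_add, hX, hY, xy, yx, xyx, yxy]
    ring
  have w2 : φ (X ^ 2 * (X + Y) ^ 2) = m 4 + 2 * m 3 * m 1 + m 2 ^ 2 := by
    have e : X ^ 2 * (X + Y) ^ 2 = X ^ 4 + X ^ 3 * Y ^ 1 + X ^ 2 * Y ^ 1 * X ^ 1 +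
        X ^ 2 * Y ^ 2 := by noncomm_ring
    rw [e]
    simp only [map_add, hX, xy, xyx]
    ring
  have w3 : φ (X ^ 2 * (X + Y) ^ 3) = m 5 + 3 * m 4 * m 1 + 3 * m 3 * m 2 + m 3 * m 1 ^ 2 +
      m 2 ^ 2 * m 1 - m 2 * m 1 ^ 3 := by
    have e : X ^ 2 * (X + Y) ^ 3 = X ^ 5 + X ^ 4 * Y ^ 1 + X ^ 3 * Y ^ 1 * X ^ 1 + X ^ 3 * Y ^ 2 +
        X ^ 2 * Y ^ 1 * X ^ 2 + X ^ 2 * Y ^ 1 * X ^ 1 * Y ^ 1 + X ^ 2 * Y ^ 2 * X ^ 1 +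
        X ^ 2 * Y ^ 3 := by noncomm_ring
    rw [e]
    simp only [map_add, hX, xy, xyx, xyxy]
    ring
  have t0 : φ (X ^ 2 * (X + Y) ^ 0 * X ^ 2) = m 4 := by
    rw [pow_zero, mul_one, ← pow_add, hX]
  have t1 : φ (X ^ 2 * (X + Y) ^ 1 * X ^ 2) = m 5 + m 1 * m 4 := by
    have e : X ^ 2 * (X + Y) ^ 1 * X ^ 2 = X ^ 5 + X ^ 2 * Y ^ 1 * X ^ 2 := by noncomm_ring
    rw [e, map_add, hX, xyx]
  obtain ⟨p0, q0⟩ := hV.map_conj h1 hW 0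
  obtain ⟨-, q1⟩ := hV.map_conj h1 hW 1
  obtain ⟨p2, -⟩ := hV.map_conj h1 hW 2
  obtain ⟨p3, -⟩ := hV.map_conj h1 hW 3
  rw [pow_zero, mul_one, hX, zero_add, s2] at p0
  rw [t0, zero_add, zero_add, s2, ← p2, w2] at q0
  rw [t1, s2, s3, ← p3, w3] at q1
  set s := 2 * m 2 + 2 * m 1 ^ 2
  set s' := 2 * m 3 + 6 * m 1 * m 2
  linear_combination s ^ 2 * q1 - s * s' * q0 + (s' * (m 4 + 2 * m 3 * m 1 + m 2 ^ 2) -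
    s * (m 5 + 3 * m 4 * m 1 + 3 * m 3 * m 2 + m 3 * m 1 ^ 2 + m 2 ^ 2 * m 1 - m 2 * m 1 ^ 3)) * p0

/-- The relation of `moment_relation` fails for the free gamma law: the two sides differ by
`(2 m₂ + 2 m₁²)² · 2 λ² / (α⁵ (λ - 1)⁹)`. -/
lemma freeGamma_moments_ne {lam α : ℝ} (hlam : 1 < lam) (hα : 0 < α) {m : ℕ → ℝ}
    (h1 : m 1 = 1 / (α * (lam - 1))) (h2 : m 2 = lam / (α ^ 2 * (lam - 1) ^ 3))
    (h3 : m 3 = lam * (lam + 1) / (α ^ 3 * (lam - 1) ^ 5))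
    (h4 : m 4 = lam * (lam ^ 2 + 3 * lam + 1) / (α ^ 4 * (lam - 1) ^ 7))
    (h5 : m 5 = lam * (lam ^ 3 + 6 * lam ^ 2 + 6 * lam + 1) / (α ^ 5 * (lam - 1) ^ 9)) :
    (2 * m 2 + 2 * m 1 ^ 2) ^ 2 * (m 5 + m 1 * m 4) ≠
      (2 * m 2 + 2 * m 1 ^ 2) * (2 * m 3 + 6 * m 1 * m 2) * m 4 -
      (2 * m 3 + 6 * m 1 * m 2) * m 2 * (m 4 + 2 * m 3 * m 1 + m 2 ^ 2) +
      (2 * m 2 + 2 * m 1 ^ 2) * m 2 *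
        (m 5 + 3 * m 4 * m 1 + 3 * m 3 * m 2 + m 3 * m 1 ^ 2 + m 2 ^ 2 * m 1 - m 2 * m 1 ^ 3) := by
  have hu : 0 < lam - 1 := by linarith
  have hl : 0 < lam := by linarith
  refine sub_ne_zero.1 ?_
  have hpos : 0 < (2 * m 2 + 2 * m 1 ^ 2) ^ 2 * (2 * lam ^ 2 / (α ^ 5 * (lam - 1) ^ 9)) := by
    rw [h1, h2]
    positivity
  refine ne_of_eq_of_ne ?_ hpos.ne'
  rw [h1, h2, h3, h4, h5]
  field_simp
  ring

end Obstruction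

end FreeProb

theorem mainTheorem3 {A : Type*} [CStarAlgebra A] (φ : A →ₗ[ℂ] ℂ) (hφ : FreeProb.IsState φ)
    (lam α : ℝ) (hlam : 1 < lam) (hα : 0 < α) (X Y : A)
    (hX : FreeProb.HasDistribution φ X (FreeProb.freeGamma lam α))
    (hY : FreeProb.HasDistribution φ Y (FreeProb.freeGamma lam α))
    (hXY : FreeProb.Free φ X Y) :
    (FreeProb.IsFaithful φ → IsUnit (X + Y)) ∧
    (IsUnit (X + Y) →
      ¬ FreeProb.Free φ (X + Y) (Ring.inverse (X + Y) * X ^ 2 * Ring.inverse (X + Y))) := by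
  refine ⟨fun hf => ?_, fun hu hV => ?_⟩
  · exact FreeProb.isUnit_add_of_isFaithful hφ hf hX hY (FreeProb.left_endpoint_pos lam hα)
      (FreeProb.ae_freeGamma_mem_Icc lam α)
  · have hW : X ^ 2 = (X + Y) * (Ring.inverse (X + Y) * X ^ 2 * Ring.inverse (X + Y)) *
        (X + Y) := by
      simp only [← mul_assoc]
      rw [Ring.mul_inverse_cancel _ hu, one_mul, mul_assoc, Ring.inverse_mul_cancel _ hu, mul_one]
    obtain ⟨m1, m2, m3, m4, m5⟩ :=
      FreeProb.moments_freeGamma hlam hα hX.isProbabilityMeasure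
    have key := FreeProb.moment_relation hφ.map_one hXY hX.moment hY.moment hV hW
    refine FreeProb.freeGamma_moments_ne hlam hα
      (m := fun r => ∫ t, t ^ r ∂(FreeProb.freeGamma lam α)) m1 m2 m3 m4 m5 ?_
    exact_mod_cast key
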